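/- Theorem. Let $q\ge 1$ and $n\ge 0$ be integers, let $A\in\mathbb{R}^{n\times n}$, and for $i,j\in\{1,\dots,q\}$ let $C_{ij}\in\mathbb{R}^{m_{ij}\times n}$ with $C_{ii}=0$. Assume: (1) $C_{ij}=C_{ji}$ for all $i,j$ (in particular $m_{ij}=m_{ji}$); (2) the graph with vertices $1,\dots,q$, in which distinct $i$ and $j$ are adjacent when $C_{ij}\neq 0$, is connected; (3) $A$ is neutrally stable: it has no eigenvalue in the open right half-plane, and for each eigenvalue on the imaginary axis every Jordan block is one-by-one; (4) for all $i,j$ with $C_{ij}\ne 0$ the pair $(C_{ij},A)$ is detectable: no (complex) eigenvector of $A$ whose eigenvalue lies in the closed right half-plane belongs to the null space of $C_{ij}$. Let $n_1$ be the number of eigenvalues of $A$ on the imaginary axis, counted with multiplicity, and $n_2=n-n_1$. If $n_1=0$, put $G_{ij}=0$ for all $i,j$. Otherwise let $U\in\mathbb{R}^{n\times n_1}$ and $W\in\mathbb{R}^{n\times n_2}$ be any matrices such that $[U\ \ W]$ is invertible and $$[U\ \ W]^{-1}A\,[U\ \ W]=\begin{bmatrix}S&0\\0&F\end{bmatrix},$$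 where $S\in\mathbb{R}^{n_1\times n_1}$ is skew-symmetric and all eigenvalues of $F\in\mathbb{R}^{n_2\times n_2}$ lie in the open left half-plane, and put $G_{ij}=UU^{T}C_{ij}^{T}$ for all $i,j$. Then the coupled systems $$\dot x_i(t)=Ax_i(t)+\sum_{j=1}^{q}G_{ij}C_{ij}\,(x_j(t)-x_i(t)),\qquad i=1,\dots,q,\quad t\ge 0,$$ synchronize, that is, every solution satisfies $\|x_i(t)-x_j(t)\|\to 0$ as $t\to\infty$ for all $i,j$. Moreover, for every solution and every $i$ the function $x_i$ is bounded on $[0,\infty)$. -/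

import Mathlib

open scoped Matrix Topology

namespace MatrixSync

/-- The complexification of a real matrix. -/
noncomputable def toC {k n : ℕ} (M : Matrix (Fin k) (Fin n) ℝ) : Matrix (Fin k) (Fin n) ℂ :=
  M.map (algebraMap ℝ ℂ)

/-- The complex linear map on `ℂⁿ` induced by a real square matrix; its eigenvalues and
eigenvectors are the (complex) eigenvalues and eigenvectors of the matrix. -/
noncomputable def endC {n : ℕ} (A : Matrix (Fin n) (Fin n) ℝ) : Module.End ℂ (Fin n → ℂ) :=
  Matrix.toLin' (toC A)

/-- Stability in continuous time: all eigenvalues lie in the open left half-plane. -/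
def IsStable {n : ℕ} (F : Matrix (Fin n) (Fin n) ℝ) : Prop :=
  ∀ μ : ℂ, (endC F).HasEigenvalue μ → μ.re < 0

/-- Neutral stability in continuous time: no eigenvalue lies in the open right half-plane, and
for each eigenvalue on the imaginary axis all Jordan blocks are one-by-one, i.e. every generalized
eigenvector for that eigenvalue is an ordinary eigenvector. -/
def IsNeutrallyStable {n : ℕ} (A : Matrix (Fin n) (Fin n) ℝ) : Prop :=
  (∀ μ : ℂ, (endC A).HasEigenvalue μ → ¬ 0 < μ.re) ∧
  (∀ μ : ℂ, (endC A).HasEigenvalue μ → μ.re = 0 →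
    (endC A).maxGenEigenspace μ = (endC A).eigenspace μ)

/-- Detectability of `(C, A)` in continuous time: no eigenvector of `A` with eigenvalue in the
closed right half-plane belongs to the null space of `C`. -/
def IsDetectable {k n : ℕ} (C : Matrix (Fin k) (Fin n) ℝ) (A : Matrix (Fin n) (Fin n) ℝ) : Prop :=
  ∀ (μ : ℂ) (v : Fin n → ℂ), (endC A).HasEigenvector μ v → 0 ≤ μ.re → toC C *ᵥ v ≠ 0

/-- The equality `C i j = C j i` for all `i, j`; it includes the equality of the row numbers
`m i j` and `m j i`. -/
def IsSymmetricFamily {q n : ℕ} {m : Fin q → Fin q → ℕ}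
    (C : ∀ i j : Fin q, Matrix (Fin (m i j)) (Fin n) ℝ) : Prop :=
  ∀ i j : Fin q, ∃ h : m i j = m j i,
    ∀ (k : Fin (m i j)) (l : Fin n), C i j k l = C j i (Fin.cast h k) l

/-- The network topology: systems `i ≠ j` are adjacent when `C i j ≠ 0` (or `C j i ≠ 0`, which is
the same thing for a symmetric family). -/
def networkGraph {q n : ℕ} {m : Fin q → Fin q → ℕ}
    (C : ∀ i j : Fin q, Matrix (Fin (m i j)) (Fin n) ℝ) : SimpleGraph (Fin q) :=
  SimpleGraph.fromRel (fun i j => C i j ≠ 0)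

/-- The number of eigenvalues of `A` on the imaginary axis, counted with multiplicity. -/
noncomputable def numImagEigenvalues {n : ℕ} (A : Matrix (Fin n) (Fin n) ℝ) : ℕ :=
  ((toC A).charpoly.roots.filter (fun μ : ℂ => μ.re = 0)).card

/-- `U`, `W`, `S`, `F` satisfy `[U W]⁻¹ A [U W] = [S 0; 0 F]` with `S` skew-symmetric and `F`
stable, where `[U W]` is a square invertible matrix. -/
def IsBlockForm {n n₁ n₂ : ℕ} (A : Matrix (Fin n) (Fin n) ℝ)
    (U : Matrix (Fin n) (Fin n₁) ℝ) (W : Matrix (Fin n) (Fin n₂) ℝ)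
    (S : Matrix (Fin n₁) (Fin n₁) ℝ) (F : Matrix (Fin n₂) (Fin n₂) ℝ) : Prop :=
  (∃ V : Matrix (Fin n₁ ⊕ Fin n₂) (Fin n) ℝ,
    V * Matrix.fromCols U W = 1 ∧ Matrix.fromCols U W * V = 1 ∧
    V * A * Matrix.fromCols U W = Matrix.fromBlocks S 0 0 F) ∧
  Sᵀ = -S ∧ IsStable F

/-- `G` is a possible output of the gain construction for the data `A`, `C`: with `n₁` the number
of eigenvalues of `A` on the imaginary axis and `n₂ = n - n₁`, all gains vanish if `n₁ = 0`, and
otherwise `G i j = U Uᵀ (C i j)ᵀ` for some choice of `U`, `W` that block-diagonalizes `A`. -/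
def IsConstructedGain {q n : ℕ} {m : Fin q → Fin q → ℕ} (A : Matrix (Fin n) (Fin n) ℝ)
    (C : ∀ i j : Fin q, Matrix (Fin (m i j)) (Fin n) ℝ)
    (G : ∀ i j : Fin q, Matrix (Fin n) (Fin (m i j)) ℝ) : Prop :=
  (numImagEigenvalues A = 0 → ∀ i j, G i j = 0) ∧
  (numImagEigenvalues A ≠ 0 →
    ∃ (U : Matrix (Fin n) (Fin (numImagEigenvalues A)) ℝ)
      (W : Matrix (Fin n) (Fin (n - numImagEigenvalues A)) ℝ)
      (S : Matrix (Fin (numImagEigenvalues A)) (Fin (numImagEigenvalues A)) ℝ)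
      (F : Matrix (Fin (n - numImagEigenvalues A)) (Fin (n - numImagEigenvalues A)) ℝ),
      IsBlockForm A U W S F ∧ ∀ i j, G i j = U * Uᵀ * (C i j)ᵀ)

/-- The control `u_i = ∑_j G_ij C_ij (x_j - x_i)` at the states `x`. -/
noncomputable def control {q n : ℕ} {m : Fin q → Fin q → ℕ}
    (C : ∀ i j : Fin q, Matrix (Fin (m i j)) (Fin n) ℝ)
    (G : ∀ i j : Fin q, Matrix (Fin n) (Fin (m i j)) ℝ)
    (x : Fin q → Fin n → ℝ) (i : Fin q) : Fin n → ℝ :=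
  ∑ j : Fin q, G i j *ᵥ (C i j *ᵥ (x j - x i))

/-- `x` is a solution, on the time interval `[0, ∞)`, of the coupled systems
`ẋ_i = A x_i + u_i` under the controls `u_i = ∑_j G_ij C_ij (x_j - x_i)`. -/
def IsSolution {q n : ℕ} {m : Fin q → Fin q → ℕ} (A : Matrix (Fin n) (Fin n) ℝ)
    (C : ∀ i j : Fin q, Matrix (Fin (m i j)) (Fin n) ℝ)
    (G : ∀ i j : Fin q, Matrix (Fin n) (Fin (m i j)) ℝ)
    (x : Fin q → ℝ → Fin n → ℝ) : Prop :=
  ∀ i : Fin q, ∀ t : ℝ, 0 ≤ t →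
    HasDerivWithinAt (x i) (A *ᵥ x i t + control C G (fun j => x j t) i) (Set.Ici 0) t

/-- The systems synchronize: `‖x_i(t) - x_j(t)‖ → 0` (Euclidean norm) as `t → ∞`, for all indices
and all solutions. -/
def Synchronize {q n : ℕ} {m : Fin q → Fin q → ℕ} (A : Matrix (Fin n) (Fin n) ℝ)
    (C : ∀ i j : Fin q, Matrix (Fin (m i j)) (Fin n) ℝ)
    (G : ∀ i j : Fin q, Matrix (Fin n) (Fin (m i j)) ℝ) : Prop :=
  ∀ x : Fin q → ℝ → Fin n → ℝ, IsSolution A C G x → ∀ i j : Fin q,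
    Filter.Tendsto (fun t : ℝ => ‖WithLp.toLp 2 (x i t - x j t)‖) Filter.atTop (𝓝 0)

/-- Every solution remains bounded on `[0, ∞)`. -/
def SolutionsBounded {q n : ℕ} {m : Fin q → Fin q → ℕ} (A : Matrix (Fin n) (Fin n) ℝ)
    (C : ∀ i j : Fin q, Matrix (Fin (m i j)) (Fin n) ℝ)
    (G : ∀ i j : Fin q, Matrix (Fin n) (Fin (m i j)) ℝ) : Prop :=
  ∀ x : Fin q → ℝ → Fin n → ℝ, IsSolution A C G x → ∀ i : Fin q,
    ∃ M : ℝ, ∀ t : ℝ, 0 ≤ t → ‖WithLp.toLp 2 (x i t)‖ ≤ M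

end MatrixSync

/-! ### Linear differential equations with marginally stable spectrum. -/

namespace MatrixSync

/-! The complexified network is one linear system `Ẋ = M X` on `q` copies of `ℂⁿ`, with `M =
coupled`. Expanding a solution along generalized eigenvectors reduces the theorem to three facts:
`M` has no eigenvalue with positive real part, it is semisimple at its imaginary eigenvalues, and
eigenvectors there have all components equal (`bounded_and_tendsto_of_solution`).

Write `[v₁; v₂] = [u w]⁻¹`. The control enters through `u`, so `v₂ X_i` evolves by the stable block
alone and vanishes on every eigenvector with `Re μ ≥ 0`. Where all `v₂ X_i` vanish, `⟨X, Y⟩ = ∑ ⟨v₁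
X_i, v₁ Y_i⟩` is positive definite and `2 Re ⟨X, M X⟩ = -∑ |c_ij (X_j - X_i)|²`
(`re_modalForm_coupled`): the skew block contributes nothing, and the factor `uᴴ` in the gain turns
`v₁ X_i` back into `X_i`. This dissipation excludes `Re μ > 0` and, by a perturbation argument,
Jordan chains at `Re μ = 0`. On an imaginary eigenvector it forces `c_ij (X_j - X_i) = 0`; the
coupling then drops out, each `X_j - X_i` satisfies the eigenvalue equation of `a`, and
detectability with connectedness makes all `X_i` equal. -/

/-- A continuous function on `ℝ` with limit zero at infinity is bounded on `[0, ∞)`. -/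
theorem exists_bound_of_tendsto_zero {E : Type*} [NormedAddCommGroup E] {y : ℝ → E}
    (hc : Continuous y) (hy : Filter.Tendsto y Filter.atTop (𝓝 0)) :
    ∃ B : ℝ, ∀ t : ℝ, 0 ≤ t → ‖y t‖ ≤ B := by
  have h1 : ∀ᶠ t in Filter.atTop, ‖y t‖ < 1 :=
    (tendsto_zero_iff_norm_tendsto_zero.1 hy).eventually (gt_mem_nhds one_pos)
  obtain ⟨s, hs⟩ := Filter.eventually_atTop.1 h1
  obtain ⟨B, hB⟩ := (isCompact_Icc (a := (0 : ℝ)) (b := s)).exists_bound_of_continuousOn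
    hc.continuousOn
  refine ⟨max B 1, fun t ht => ?_⟩
  rcases le_total t s with h | h
  · exact (hB t ⟨ht, h⟩).trans (le_max_left _ _)
  · exact (hs t h).le.trans (le_max_right _ _)

/-- The functions `t ↦ e^{μ t} t^k / k!` that make up the solutions of a linear differential
equation starting at a generalized eigenvector. -/
noncomputable def expMonomial (μ : ℂ) (k : ℕ) (t : ℝ) : ℂ :=
  Complex.exp (μ * t) * ((t : ℂ) ^ k / (k.factorial : ℂ))

theorem hasDerivAt_expMonomial_zero (μ : ℂ) (t : ℝ) :
    HasDerivAt (expMonomial μ 0) (μ * expMonomial μ 0 t) t := by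
  have h : HasDerivAt (fun s : ℂ => Complex.exp (μ * s)) (Complex.exp (μ * t) * (μ * 1)) t :=
    ((hasDerivAt_id _).const_mul μ).cexp
  have h' := h.comp_ofReal
  unfold expMonomial
  simpa [mul_comm] using h'

theorem hasDerivAt_expMonomial_succ (μ : ℂ) (k : ℕ) (t : ℝ) :
    HasDerivAt (expMonomial μ (k + 1)) (μ * expMonomial μ (k + 1) t + expMonomial μ k t) t := by
  have h : HasDerivAt (fun s : ℂ => Complex.exp (μ * s)) (Complex.exp (μ * t) * (μ * 1)) t :=
    ((hasDerivAt_id _).const_mul μ).cexp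
  have h2 : HasDerivAt (fun s : ℂ => s ^ (k + 1) / ((k + 1).factorial : ℂ)) _ (t : ℂ) :=
    (hasDerivAt_pow (k + 1) (t : ℂ)).div_const _
  have h' := (h.mul h2).comp_ofReal
  have hk : ((k : ℂ) + 1) ≠ 0 := by exact_mod_cast Nat.succ_ne_zero k
  have hk' : (k.factorial : ℂ) ≠ 0 := by exact_mod_cast Nat.factorial_ne_zero k
  unfold expMonomial
  refine h'.congr_deriv ?_
  rw [Nat.factorial_succ, add_tsub_cancel_right]
  push_cast
  field_simp

theorem tendsto_expMonomial {μ : ℂ} (hμ : μ.re < 0) (k : ℕ) :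
    Filter.Tendsto (expMonomial μ k) Filter.atTop (𝓝 0) := by
  rw [tendsto_zero_iff_norm_tendsto_zero]
  have h := (tendsto_rpow_mul_exp_neg_mul_atTop_nhds_zero (k : ℝ) (-μ.re) (by linarith)).div_const
    (k.factorial : ℝ)
  rw [zero_div] at h
  refine h.congr' ?_
  filter_upwards [Filter.eventually_ge_atTop 0] with t ht
  rw [expMonomial]
  simp only [norm_mul, norm_div, norm_pow, Complex.norm_exp, Complex.norm_real,
    Complex.norm_natCast, Real.norm_of_nonneg ht, Real.rpow_natCast, neg_neg]
  rw [show (μ * (t : ℂ)).re = μ.re * t by simp]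
  ring

section

variable {E : Type*} [NormedAddCommGroup E] [NormedSpace ℂ E]

/-- Truncation of `e^{tT} v = e^{μt} ∑ t^k / k! (T - μ)^k v`. The derivative telescopes, leaving one
boundary term, which dies when `(T - μ)^(d + 1)` kills `v`. -/
theorem hasDerivAt_sum_expMonomial (T : E →ₗ[ℂ] E) (μ : ℂ) (v : E) (d : ℕ) (t : ℝ) :
    HasDerivAt (fun s : ℝ => ∑ k ∈ Finset.range (d + 1),
        expMonomial μ k s • ((T - algebraMap ℂ (Module.End ℂ E) μ) ^ k) v)
      (T (∑ k ∈ Finset.range (d + 1),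
        expMonomial μ k t • ((T - algebraMap ℂ (Module.End ℂ E) μ) ^ k) v) -
        expMonomial μ d t • ((T - algebraMap ℂ (Module.End ℂ E) μ) ^ (d + 1)) v) t := by
  have key : ∀ k, T (((T - algebraMap ℂ (Module.End ℂ E) μ) ^ k) v) =
      ((T - algebraMap ℂ (Module.End ℂ E) μ) ^ (k + 1)) v +
        μ • ((T - algebraMap ℂ (Module.End ℂ E) μ) ^ k) v := fun k => by
    rw [pow_succ', Module.End.mul_apply, LinearMap.sub_apply, Module.algebraMap_end_apply,
      sub_add_cancel]
  induction d with
  | zero =>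
    simp only [zero_add, Finset.sum_range_one, map_smul, key 0]
    convert (hasDerivAt_expMonomial_zero μ t).smul_const
      (((T - algebraMap ℂ (Module.End ℂ E) μ) ^ 0) v) using 1
    module
  | succ d ih =>
    rw [show (fun s : ℝ => ∑ k ∈ Finset.range (d + 1 + 1),
        expMonomial μ k s • ((T - algebraMap ℂ (Module.End ℂ E) μ) ^ k) v) = _ from
      funext fun s => Finset.sum_range_succ _ (d + 1)]
    refine (ih.add ((hasDerivAt_expMonomial_succ μ d t).smul_const
      (((T - algebraMap ℂ (Module.End ℂ E) μ) ^ (d + 1)) v))).congr_deriv ?_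
    rw [Finset.sum_range_succ _ (d + 1), map_add, map_smul, key (d + 1)]
    module

variable {E' : Type*} [NormedAddCommGroup E'] [NormedSpace ℂ E']

/-- If `T` has no eigenvalue with positive real part and is semisimple at its imaginary eigenvalues,
then from every initial value there is a bounded solution of `ẏ = T y`, and every linear map that
kills the eigenvectors with imaginary eigenvalues tends to zero along it. -/
theorem exists_bounded_solution [FiniteDimensional ℂ E] (T : E →ₗ[ℂ] E) (L : E →ₗ[ℂ] E')
    (hpos : ∀ (μ : ℂ) (v : E), T v = μ • v → 0 < μ.re → v = 0)
    (hss : ∀ (μ : ℂ) (v : E), μ.re = 0 → T (T v - μ • v) = μ • (T v - μ • v) → T v = μ • v)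
    (hL : ∀ (μ : ℂ) (v : E), T v = μ • v → μ.re = 0 → L v = 0) (v : E) :
    ∃ y : ℝ → E, y 0 = v ∧ (∀ t, HasDerivAt y (T (y t)) t) ∧
      (∃ B : ℝ, ∀ t : ℝ, 0 ≤ t → ‖y t‖ ≤ B) ∧
      Filter.Tendsto (fun t => L (y t)) Filter.atTop (𝓝 0) := by
  have hv : v ∈ ⨆ μ, Module.End.maxGenEigenspace T μ := by
    rw [Module.End.iSup_maxGenEigenspace_eq_top]
    trivial
  induction hv using Submodule.iSup_induction' with
  | zero =>
    refine ⟨fun _ => 0, rfl, fun t => ?_, ⟨0, by simp⟩, by simp⟩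
    simpa using hasDerivAt_const t (0 : E)
  | add v w _ _ hv hw =>
    obtain ⟨y, hy0, hy, ⟨B, hB⟩, hyL⟩ := hv
    obtain ⟨z, hz0, hz, ⟨B', hB'⟩, hzL⟩ := hw
    refine ⟨fun t => y t + z t, by simp [hy0, hz0], fun t => ?_, ⟨B + B', fun t ht => ?_⟩, ?_⟩
    · rw [map_add]
      exact (hy t).add (hz t)
    · exact (norm_add_le _ _).trans (add_le_add (hB t ht) (hB' t ht))
    · simpa using hyL.add hzL
  | mem μ v hv =>
    obtain ⟨d, hd⟩ := (Module.End.mem_maxGenEigenspace T μ v).1 hv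
    replace hd : ((T - algebraMap ℂ (Module.End ℂ E) μ) ^ d) v = 0 := by
      simpa [Algebra.algebraMap_eq_smul_one] using hd
    have happ : ∀ w, (T - algebraMap ℂ (Module.End ℂ E) μ) w = T w - μ • w := fun w => by
      rw [LinearMap.sub_apply, Module.algebraMap_end_apply]
    rcases lt_trichotomy μ.re 0 with hμ | hμ | hμ
    · have hder : ∀ t, HasDerivAt (fun s : ℝ => ∑ k ∈ Finset.range (d + 1),
          expMonomial μ k s • ((T - algebraMap ℂ (Module.End ℂ E) μ) ^ k) v)
          (T (∑ k ∈ Finset.range (d + 1),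
            expMonomial μ k t • ((T - algebraMap ℂ (Module.End ℂ E) μ) ^ k) v)) t := fun t => by
        have h := hasDerivAt_sum_expMonomial T μ v d t
        rwa [pow_succ', Module.End.mul_apply, hd, map_zero, smul_zero, sub_zero] at h
      have hlim : Filter.Tendsto (fun s : ℝ => ∑ k ∈ Finset.range (d + 1),
          expMonomial μ k s • ((T - algebraMap ℂ (Module.End ℂ E) μ) ^ k) v)
          Filter.atTop (𝓝 0) := by
        rw [← Finset.sum_const_zero (s := Finset.range (d + 1))]
        refine tendsto_finsetSum _ fun k _ => ?_
        simpa using (tendsto_expMonomial hμ k).smul_const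
          (((T - algebraMap ℂ (Module.End ℂ E) μ) ^ k) v)
      refine ⟨_, ?_, hder, exists_bound_of_tendsto_zero
        (continuous_iff_continuousAt.2 fun t => (hder t).continuousAt) hlim, ?_⟩
      · rw [Finset.sum_range_succ', Finset.sum_eq_zero]
        · simp [expMonomial]
        · simp [expMonomial]
      · have h := (L.continuous_of_finiteDimensional.tendsto 0).comp hlim
        rwa [map_zero] at h
    · have hev : T v = μ • v := by
        have : ∀ k, ((T - algebraMap ℂ (Module.End ℂ E) μ) ^ (k + 1)) v = 0 → T v = μ • v := by
          intro k
          induction k with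
          | zero => intro h; rw [zero_add, pow_one, happ] at h; exact sub_eq_zero.1 h
          | succ k ih =>
            intro h
            -- Semisimplicity, applied to `(T - μ)^k v`, lowers the exponent from `k + 2` to `k +
            -- 1`.
            refine ih ?_
            rw [pow_succ', pow_succ', Module.End.mul_apply, Module.End.mul_apply] at h
            rw [pow_succ', Module.End.mul_apply, happ]
            rw [happ, happ] at h
            exact sub_eq_zero.2 (hss μ _ hμ (sub_eq_zero.1 h))
        exact this d (by rw [pow_succ', Module.End.mul_apply, hd, map_zero])
      refine ⟨fun t => expMonomial μ 0 t • v, by simp [expMonomial], fun t => ?_,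
        ⟨‖v‖, fun t _ => ?_⟩, ?_⟩
      · simp only [map_smul, hev]
        convert (hasDerivAt_expMonomial_zero μ t).smul_const v using 1
        module
      · rw [norm_smul]
        simp [expMonomial, Complex.norm_exp, hμ]
      · simp [hL μ v hev hμ]
    · have hv0 : v = 0 := by
        have : ∀ k, ((T - algebraMap ℂ (Module.End ℂ E) μ) ^ k) v = 0 → v = 0 := by
          intro k
          induction k with
          | zero => simp
          | succ k ih =>
            intro h
            rw [pow_succ', Module.End.mul_apply, happ] at h
            exact ih (hpos μ _ (sub_eq_zero.1 h) hμ)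
        exact this d hd
      refine ⟨fun _ => 0, hv0.symm, fun t => ?_, ⟨0, by simp⟩, by simp⟩
      simpa using hasDerivAt_const t (0 : E)

/-- Under the spectral conditions of `exists_bounded_solution`, all solutions on `[0, ∞)` are
bounded and `L` tends to zero along them. -/
theorem bounded_and_tendsto_of_solution [FiniteDimensional ℂ E] (T : E →ₗ[ℂ] E) (L : E →ₗ[ℂ] E')
    (hpos : ∀ (μ : ℂ) (v : E), T v = μ • v → 0 < μ.re → v = 0)
    (hss : ∀ (μ : ℂ) (v : E), μ.re = 0 → T (T v - μ • v) = μ • (T v - μ • v) → T v = μ • v)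
    (hL : ∀ (μ : ℂ) (v : E), T v = μ • v → μ.re = 0 → L v = 0) (x : ℝ → E)
    (hx : ∀ t, 0 ≤ t → HasDerivWithinAt x (T (x t)) (Set.Ici 0) t) :
    (∃ B : ℝ, ∀ t : ℝ, 0 ≤ t → ‖x t‖ ≤ B) ∧
      Filter.Tendsto (fun t => L (x t)) Filter.atTop (𝓝 0) := by
  obtain ⟨y, hy0, hy, ⟨B, hB⟩, hyL⟩ := exists_bounded_solution T L hpos hss hL (x 0)
  have hxy : ∀ t, 0 ≤ t → x t = y t := fun t ht =>
    ODE_solution_unique (v := fun _ => T) (a := 0) (b := t)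
      (fun _ => (LinearMap.toContinuousLinearMap T).lipschitz)
      (fun s hs => ((hx s hs.1).continuousWithinAt).mono fun r hr => hr.1)
      (fun s hs => (hx s hs.1).mono (Set.Ici_subset_Ici.2 hs.1))
      (fun s _ => (hy s).continuousAt.continuousWithinAt)
      (fun s _ => (hy s).hasDerivWithinAt) hy0.symm ⟨ht, le_rfl⟩
  refine ⟨⟨B, fun t ht => hxy t ht ▸ hB t ht⟩, hyL.congr' ?_⟩
  filter_upwards [Filter.eventually_ge_atTop 0] with t ht
  rw [hxy t ht]

end

end MatrixSync

/-! ### Spectrum of the complexified network. -/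

namespace MatrixSync

section

variable {q n n₁ n₂ : ℕ} {m : Fin q → Fin q → ℕ}

/-- The complexified vector field of the network whose gains are `u uᴴ (c i j)ᴴ`. -/
noncomputable def coupled (a : Matrix (Fin n) (Fin n) ℂ) (u : Matrix (Fin n) (Fin n₁) ℂ)
    (c : ∀ i j : Fin q, Matrix (Fin (m i j)) (Fin n) ℂ) :
    (Fin q → Fin n → ℂ) →ₗ[ℂ] (Fin q → Fin n → ℂ) :=
  LinearMap.pi fun i => a.mulVecLin ∘ₗ LinearMap.proj (φ := fun _ => Fin n → ℂ) i +
    ∑ j, (u * (uᴴ * ((c i j)ᴴ * c i j))).mulVecLin ∘ₗ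
      (LinearMap.proj (R := ℂ) (φ := fun _ : Fin q => Fin n → ℂ) j -
        LinearMap.proj (R := ℂ) (φ := fun _ : Fin q => Fin n → ℂ) i)

theorem coupled_apply (a : Matrix (Fin n) (Fin n) ℂ) (u : Matrix (Fin n) (Fin n₁) ℂ)
    (c : ∀ i j : Fin q, Matrix (Fin (m i j)) (Fin n) ℂ) (X : Fin q → Fin n → ℂ) (i : Fin q) :
    coupled a u c X i =
      a *ᵥ X i + ∑ j, (u * (uᴴ * ((c i j)ᴴ * c i j))) *ᵥ (X j - X i) := by
  simp [coupled]

/-- The algebraic data behind synchronization: `a` splits along `[u w]`, with inverse `[v₁; v₂]`,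
into a skew-Hermitian block `s` and a stable block `f`, and the output matrices `c` are symmetric,
detectable and connect the network. -/
structure IsModalNetwork (a : Matrix (Fin n) (Fin n) ℂ) (u : Matrix (Fin n) (Fin n₁) ℂ)
    (w : Matrix (Fin n) (Fin n₂) ℂ) (v₁ : Matrix (Fin n₁) (Fin n) ℂ)
    (v₂ : Matrix (Fin n₂) (Fin n) ℂ) (s : Matrix (Fin n₁) (Fin n₁) ℂ)
    (f : Matrix (Fin n₂) (Fin n₂) ℂ)
    (c : ∀ i j : Fin q, Matrix (Fin (m i j)) (Fin n) ℂ) : Prop where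
  skew_block : v₁ * a = s * v₁
  stable_block : v₂ * a = f * v₂
  left_inv : v₁ * u = 1
  cross : v₂ * u = 0
  right_inv : u * v₁ + w * v₂ = 1
  skew : sᴴ = -s
  stable : ∀ (μ : ℂ) (z : Fin n₂ → ℂ), f *ᵥ z = μ • z → 0 ≤ μ.re → z = 0
  symm : ∀ i j, (c i j)ᴴ * c i j = (c j i)ᴴ * c j i
  detect : ∀ i j, c i j ≠ 0 → ∀ (μ : ℂ) (z : Fin n → ℂ), a *ᵥ z = μ • z → 0 ≤ μ.re →
    c i j *ᵥ z = 0 → z = 0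
  connected : ∀ X : Fin q → Fin n → ℂ, (∀ i j, c i j ≠ 0 → X i = X j) → ∀ i j, X i = X j

/-- The Hermitian form `∑ i, ⟨v X_i, v Y_i⟩`. -/
noncomputable def modalForm (v : Matrix (Fin n₁) (Fin n) ℂ) (X Y : Fin q → Fin n → ℂ) : ℂ :=
  ∑ i, star (v *ᵥ X i) ⬝ᵥ (v *ᵥ Y i)

theorem star_dotProduct_self_eq {k : ℕ} (x : Fin k → ℂ) :
    star x ⬝ᵥ x = ((∑ l, Complex.normSq (x l) : ℝ) : ℂ) := by
  simp [dotProduct, Complex.normSq_eq_conj_mul_self]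

theorem modalForm_self (v : Matrix (Fin n₁) (Fin n) ℂ) (X : Fin q → Fin n → ℂ) :
    modalForm v X X = ((∑ i, ∑ l, Complex.normSq ((v *ᵥ X i) l) : ℝ) : ℂ) := by
  simp [modalForm, star_dotProduct_self_eq]

theorem modalForm_self_re_nonneg (v : Matrix (Fin n₁) (Fin n) ℂ) (X : Fin q → Fin n → ℂ) :
    0 ≤ (modalForm v X X).re := by
  rw [modalForm_self, Complex.ofReal_re]
  exact Finset.sum_nonneg fun i _ => Finset.sum_nonneg fun l _ => Complex.normSq_nonneg _

theorem mulVec_eq_zero_of_modalForm_self {v : Matrix (Fin n₁) (Fin n) ℂ} {X : Fin q → Fin n → ℂ}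
    (h : (modalForm v X X).re = 0) (i : Fin q) : v *ᵥ X i = 0 := by
  rw [modalForm_self, Complex.ofReal_re, Finset.sum_eq_zero_iff_of_nonneg
    fun i _ => Finset.sum_nonneg fun l _ => Complex.normSq_nonneg _] at h
  have hi := h i (Finset.mem_univ i)
  rw [Finset.sum_eq_zero_iff_of_nonneg fun l _ => Complex.normSq_nonneg _] at hi
  exact funext fun l => Complex.normSq_eq_zero.1 (hi l (Finset.mem_univ l))

theorem modalForm_add_right (v : Matrix (Fin n₁) (Fin n) ℂ) (X Y Z : Fin q → Fin n → ℂ) :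
    modalForm v X (Y + Z) = modalForm v X Y + modalForm v X Z := by
  simp [modalForm, Matrix.mulVec_add, Finset.sum_add_distrib]

theorem modalForm_add_left (v : Matrix (Fin n₁) (Fin n) ℂ) (X Y Z : Fin q → Fin n → ℂ) :
    modalForm v (X + Y) Z = modalForm v X Z + modalForm v Y Z := by
  simp [modalForm, Matrix.mulVec_add, Finset.sum_add_distrib]

theorem modalForm_smul_right (v : Matrix (Fin n₁) (Fin n) ℂ) (z : ℂ) (X Y : Fin q → Fin n → ℂ) :
    modalForm v X (z • Y) = z * modalForm v X Y := by
  simp [modalForm, Matrix.mulVec_smul, Finset.mul_sum]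

theorem modalForm_smul_left (v : Matrix (Fin n₁) (Fin n) ℂ) (z : ℂ) (X Y : Fin q → Fin n → ℂ) :
    modalForm v (z • X) Y = star z * modalForm v X Y := by
  simp [modalForm, Matrix.mulVec_smul, Finset.mul_sum]

/-- A symmetric family of kernels `(c i j)ᴴ (c i j)` couples the differences dissipatively. -/
theorem sum_coupling (c : ∀ i j : Fin q, Matrix (Fin (m i j)) (Fin n) ℂ)
    (hc : ∀ i j, (c i j)ᴴ * c i j = (c j i)ᴴ * c j i) (X : Fin q → Fin n → ℂ) :
    2 * ∑ i, ∑ j, star (X i) ⬝ᵥ (((c i j)ᴴ * c i j) *ᵥ (X j - X i)) =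
      -∑ i, ∑ j, star (c i j *ᵥ (X j - X i)) ⬝ᵥ (c i j *ᵥ (X j - X i)) := by
  -- Averaging the sum with its copy under `i ↔ j` replaces `X_i` on the left by a difference; the
  -- kernels agree by symmetry.
  have hswap : ∑ i, ∑ j, star (X i) ⬝ᵥ (((c i j)ᴴ * c i j) *ᵥ (X j - X i)) =
      ∑ i, ∑ j, star (X j) ⬝ᵥ (((c i j)ᴴ * c i j) *ᵥ (X i - X j)) := by
    rw [Finset.sum_comm]
    exact Finset.sum_congr rfl fun i _ => Finset.sum_congr rfl fun j _ => by rw [hc j i]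
  rw [two_mul]
  nth_rewrite 2 [hswap]
  simp only [← Finset.sum_add_distrib, ← Finset.sum_neg_distrib]
  refine Finset.sum_congr rfl fun i _ => Finset.sum_congr rfl fun j _ => ?_
  rw [Matrix.star_mulVec, ← Matrix.dotProduct_mulVec, Matrix.mulVec_mulVec, star_sub,
    sub_dotProduct, ← neg_sub (X j) (X i), Matrix.mulVec_neg, dotProduct_neg]
  ring

end

namespace IsModalNetwork

variable {q n n₁ n₂ : ℕ} {m : Fin q → Fin q → ℕ} {a : Matrix (Fin n) (Fin n) ℂ}
  {u : Matrix (Fin n) (Fin n₁) ℂ} {w : Matrix (Fin n) (Fin n₂) ℂ} {v₁ : Matrix (Fin n₁) (Fin n) ℂ}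
  {v₂ : Matrix (Fin n₂) (Fin n) ℂ} {s : Matrix (Fin n₁) (Fin n₁) ℂ}
  {f : Matrix (Fin n₂) (Fin n₂) ℂ} {c : ∀ i j : Fin q, Matrix (Fin (m i j)) (Fin n) ℂ}

theorem eq_mulVec (h : IsModalNetwork a u w v₁ v₂ s f c) {x : Fin n → ℂ} (hx : v₂ *ᵥ x = 0) :
    u *ᵥ (v₁ *ᵥ x) = x := by
  have := congrArg (· *ᵥ x) h.right_inv
  simpa [Matrix.add_mulVec, ← Matrix.mulVec_mulVec, hx] using this

/-- Every coupling term has `u` as its left factor, and `v₂ u = 0`. -/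
theorem mulVec_coupled_stable (h : IsModalNetwork a u w v₁ v₂ s f c) (X : Fin q → Fin n → ℂ)
    (i : Fin q) : v₂ *ᵥ coupled a u c X i = f *ᵥ (v₂ *ᵥ X i) := by
  rw [coupled_apply, Matrix.mulVec_add, Matrix.mulVec_sum, Matrix.mulVec_mulVec, h.stable_block,
    Matrix.mulVec_mulVec, Finset.sum_eq_zero, add_zero]
  intro j _
  rw [Matrix.mulVec_mulVec, ← Matrix.mul_assoc, h.cross, Matrix.zero_mul, Matrix.zero_mulVec]

theorem mulVec_coupled_skew (h : IsModalNetwork a u w v₁ v₂ s f c) (X : Fin q → Fin n → ℂ)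
    (i : Fin q) : v₁ *ᵥ coupled a u c X i =
      s *ᵥ (v₁ *ᵥ X i) + ∑ j, uᴴ *ᵥ (((c i j)ᴴ * c i j) *ᵥ (X j - X i)) := by
  rw [coupled_apply, Matrix.mulVec_add, Matrix.mulVec_sum, Matrix.mulVec_mulVec, h.skew_block,
    Matrix.mulVec_mulVec]
  refine congrArg _ (Finset.sum_congr rfl fun j _ => ?_)
  rw [Matrix.mulVec_mulVec, ← Matrix.mul_assoc, h.left_inv, Matrix.one_mul, Matrix.mulVec_mulVec]

theorem re_skew (h : IsModalNetwork a u w v₁ v₂ s f c) (x : Fin n₁ → ℂ) :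
    (star x ⬝ᵥ (s *ᵥ x)).re = 0 := by
  have h1 : star (star x ⬝ᵥ (s *ᵥ x)) = -(star x ⬝ᵥ (s *ᵥ x)) := by
    rw [← Matrix.star_dotProduct_star, star_star, Matrix.star_mulVec, h.skew,
      ← Matrix.dotProduct_mulVec, Matrix.neg_mulVec, dotProduct_neg]
  have h2 := congrArg Complex.re h1
  simp only [Complex.star_def, Complex.conj_re, Complex.neg_re] at h2
  linarith

/-- The dissipation identity on the subspace where the stable components vanish. -/
theorem re_modalForm_coupled (h : IsModalNetwork a u w v₁ v₂ s f c) {X : Fin q → Fin n → ℂ}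
    (hX : ∀ i, v₂ *ᵥ X i = 0) :
    2 * (modalForm v₁ X (coupled a u c X)).re =
      -∑ i, ∑ j, ∑ l, Complex.normSq ((c i j *ᵥ (X j - X i)) l) := by
  have h1 : modalForm v₁ X (coupled a u c X) = ∑ i, star (v₁ *ᵥ X i) ⬝ᵥ (s *ᵥ (v₁ *ᵥ X i)) +
      ∑ i, ∑ j, star (X i) ⬝ᵥ (((c i j)ᴴ * c i j) *ᵥ (X j - X i)) := by
    rw [modalForm, ← Finset.sum_add_distrib]
    refine Finset.sum_congr rfl fun i _ => ?_
    rw [h.mulVec_coupled_skew, dotProduct_add, dotProduct_sum]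
    refine congrArg _ (Finset.sum_congr rfl fun j _ => ?_)
    -- Moving `uᴴ` to the left slot produces `u v₁ X_i`, which is `X_i` because `v₂ X_i = 0`.
    rw [Matrix.dotProduct_mulVec, ← Matrix.star_mulVec, h.eq_mulVec (hX i)]
  have h2 := congrArg Complex.re (sum_coupling c h.symm X)
  simp only [star_dotProduct_self_eq, ← Complex.ofReal_sum, Complex.neg_re, Complex.ofReal_re] at h2
  rw [h1, Complex.add_re, Complex.re_sum, Finset.sum_eq_zero fun i _ => h.re_skew _, zero_add, ← h2]
  simp

theorem re_modalForm_coupled_nonpos (h : IsModalNetwork a u w v₁ v₂ s f c)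
    {X : Fin q → Fin n → ℂ} (hX : ∀ i, v₂ *ᵥ X i = 0) :
    (modalForm v₁ X (coupled a u c X)).re ≤ 0 := by
  have h1 := h.re_modalForm_coupled hX
  have h2 : 0 ≤ ∑ i, ∑ j, ∑ l, Complex.normSq ((c i j *ᵥ (X j - X i)) l) :=
    Finset.sum_nonneg fun i _ => Finset.sum_nonneg fun j _ => Finset.sum_nonneg fun l _ =>
      Complex.normSq_nonneg _
  linarith

theorem eq_zero_of_modalForm_self (h : IsModalNetwork a u w v₁ v₂ s f c) {X : Fin q → Fin n → ℂ}
    (hX : ∀ i, v₂ *ᵥ X i = 0) (h0 : (modalForm v₁ X X).re = 0) : X = 0 := by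
  funext i
  rw [← h.eq_mulVec (hX i), mulVec_eq_zero_of_modalForm_self h0 i, Matrix.mulVec_zero, Pi.zero_apply]

theorem stable_component_eq_zero (h : IsModalNetwork a u w v₁ v₂ s f c) {μ : ℂ} (hμ : 0 ≤ μ.re)
    {X : Fin q → Fin n → ℂ} (hX : coupled a u c X = μ • X) (i : Fin q) : v₂ *ᵥ X i = 0 :=
  h.stable μ _ (by rw [← h.mulVec_coupled_stable, hX, Pi.smul_apply, Matrix.mulVec_smul]) hμ

theorem re_modalForm_smul_self (v : Matrix (Fin n₁) (Fin n) ℂ) (μ : ℂ) (X : Fin q → Fin n → ℂ) :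
    (μ * modalForm v X X).re = μ.re * (modalForm v X X).re := by
  rw [modalForm_self]
  simp

theorem eq_zero_of_re_pos (h : IsModalNetwork a u w v₁ v₂ s f c) (μ : ℂ) (X : Fin q → Fin n → ℂ)
    (hX : coupled a u c X = μ • X) (hμ : 0 < μ.re) : X = 0 := by
  have hst := h.stable_component_eq_zero hμ.le hX
  have h1 := h.re_modalForm_coupled_nonpos hst
  rw [hX, modalForm_smul_right, re_modalForm_smul_self] at h1
  exact h.eq_zero_of_modalForm_self hst
    (le_antisymm (nonpos_of_mul_nonpos_right h1 hμ) (modalForm_self_re_nonneg v₁ X))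

/-- With `Re μ = 0` the dissipation is zero, so every `c_ij (X_j - X_i)` vanishes. Each `X_i` then
solves the uncoupled eigenvalue equation, and detectability applies to the differences along edges.
-/
theorem synchronous_of_re_eq_zero (h : IsModalNetwork a u w v₁ v₂ s f c) (μ : ℂ)
    (X : Fin q → Fin n → ℂ) (hX : coupled a u c X = μ • X) (hμ : μ.re = 0) (i j : Fin q) :
    X i = X j := by
  have hst := h.stable_component_eq_zero hμ.ge hX
  have h1 := h.re_modalForm_coupled hst
  rw [hX, modalForm_smul_right, re_modalForm_smul_self, hμ, zero_mul, mul_zero, zero_eq_neg,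
    Finset.sum_eq_zero_iff_of_nonneg fun i _ => Finset.sum_nonneg fun j _ =>
      Finset.sum_nonneg fun l _ => Complex.normSq_nonneg _] at h1
  have hc : ∀ i j, c i j *ᵥ (X j - X i) = 0 := fun i j => by
    have h2 := h1 i (Finset.mem_univ i)
    rw [Finset.sum_eq_zero_iff_of_nonneg fun j _ =>
      Finset.sum_nonneg fun l _ => Complex.normSq_nonneg _] at h2
    have h3 := h2 j (Finset.mem_univ j)
    rw [Finset.sum_eq_zero_iff_of_nonneg fun l _ => Complex.normSq_nonneg _] at h3
    exact funext fun l => Complex.normSq_eq_zero.1 (h3 l (Finset.mem_univ l))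
  have ha : ∀ i, a *ᵥ X i = μ • X i := fun i => by
    have h2 := congrFun hX i
    rw [coupled_apply, Finset.sum_eq_zero, add_zero] at h2
    · exact h2
    · intro j _
      simp only [← Matrix.mulVec_mulVec, hc, Matrix.mulVec_zero]
  refine h.connected X (fun i j hij => ?_) i j
  refine (sub_eq_zero.1 (h.detect i j hij μ (X j - X i) ?_ hμ.ge (hc i j))).symm
  rw [Matrix.mulVec_sub, ha, ha, smul_sub]

theorem eq_zero_of_forall_mul_add_sq_nonpos {p k : ℝ} (h : ∀ r : ℝ, r * p + r ^ 2 * k ≤ 0) :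
    p = 0 := by
  by_contra hp
  -- This `r` has the sign of `p` and is small enough for the linear term to dominate.
  have h1 := h (p / (|k| + 1))
  have h2 : p / (|k| + 1) * p + (p / (|k| + 1)) ^ 2 * k =
      p ^ 2 / (|k| + 1) ^ 2 * (|k| + 1 + k) := by
    field_simp
  have h3 : 0 < p ^ 2 / (|k| + 1) ^ 2 * (|k| + 1 + k) :=
    mul_pos (by positivity) (by linarith [neg_abs_le k])
  linarith

/-- A Jordan chain `M X = μ X + Y`, `M Y = μ Y` is tested on `Y + r X`. Since `Re μ = 0`,
dissipation reads `r ⟨Y, Y⟩ + r² Re ⟨X, Y⟩ ≤ 0` for all real `r`, and its linear coefficient must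
vanish, so `Y = 0`. -/
theorem semisimple_of_re_eq_zero (h : IsModalNetwork a u w v₁ v₂ s f c) (μ : ℂ)
    (X : Fin q → Fin n → ℂ) (hμ : μ.re = 0)
    (hX : coupled a u c (coupled a u c X - μ • X) = μ • (coupled a u c X - μ • X)) :
    coupled a u c X = μ • X := by
  obtain ⟨Y, hY⟩ : ∃ Y, Y = coupled a u c X - μ • X := ⟨_, rfl⟩
  rw [← hY] at hX
  have hMX : coupled a u c X = μ • X + Y := by rw [hY]; abel
  have hYst := h.stable_component_eq_zero hμ.ge hX
  -- Since `v₂ Y_i = 0`, the vector `v₂ X_i` satisfies the eigenvalue equation of `f` for `μ`,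
  -- although `X` need not be an eigenvector of `M`.
  have hXst : ∀ i, v₂ *ᵥ X i = 0 := fun i => by
    refine h.stable μ _ ?_ hμ.ge
    rw [← h.mulVec_coupled_stable, hMX, Pi.add_apply, Matrix.mulVec_add, hYst, add_zero,
      Pi.smul_apply, Matrix.mulVec_smul]
  have key : ∀ r : ℝ, r * (modalForm v₁ Y Y).re + r ^ 2 * (modalForm v₁ X Y).re ≤ 0 := fun r => by
    have h1 := h.re_modalForm_coupled_nonpos (X := Y + (r : ℂ) • X) fun i => by
      rw [Pi.add_apply, Pi.smul_apply, Matrix.mulVec_add, Matrix.mulVec_smul, hYst, hXst,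
        smul_zero, add_zero]
    have h2 : coupled a u c (Y + (r : ℂ) • X) = μ • (Y + (r : ℂ) • X) + (r : ℂ) • Y := by
      rw [map_add, map_smul, hX, hMX]
      module
    rw [h2, modalForm_add_right, modalForm_smul_right, Complex.add_re, re_modalForm_smul_self, hμ,
      zero_mul, zero_add, modalForm_smul_right, modalForm_add_left, modalForm_smul_left] at h1
    simp only [Complex.star_def, Complex.conj_ofReal, Complex.re_ofReal_mul, Complex.add_re] at h1
    linarith
  rw [hMX, h.eq_zero_of_modalForm_self hYst (eq_zero_of_forall_mul_add_sq_nonpos key), add_zero]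

end IsModalNetwork

end MatrixSync

/-! ### Transfer from the real data to the complex network and back. -/

namespace MatrixSync

theorem toC_mul {k l n : ℕ} (M : Matrix (Fin k) (Fin l) ℝ) (N : Matrix (Fin l) (Fin n) ℝ) :
    toC (M * N) = toC M * toC N :=
  Matrix.map_mul

theorem toC_add {k n : ℕ} (M N : Matrix (Fin k) (Fin n) ℝ) : toC (M + N) = toC M + toC N :=
  Matrix.map_add _ (map_add _) M N

theorem toC_neg {k n : ℕ} (M : Matrix (Fin k) (Fin n) ℝ) : toC (-M) = -toC M := by
  ext i j
  simp [toC]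

theorem toC_zero {k n : ℕ} : toC (0 : Matrix (Fin k) (Fin n) ℝ) = 0 :=
  Matrix.map_zero _ (map_zero _)

theorem toC_one {n : ℕ} : toC (1 : Matrix (Fin n) (Fin n) ℝ) = 1 :=
  Matrix.map_one _ (map_zero _) (map_one _)

theorem conjTranspose_toC {k n : ℕ} (M : Matrix (Fin k) (Fin n) ℝ) : (toC M)ᴴ = toC Mᵀ := by
  ext i j
  simp [toC]

theorem toC_mulVec {k n : ℕ} (M : Matrix (Fin k) (Fin n) ℝ) (v : Fin n → ℝ) (i : Fin k) :
    (toC M *ᵥ fun l => (v l : ℂ)) i = ((M *ᵥ v) i : ℂ) :=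
  (RingHom.map_mulVec (algebraMap ℝ ℂ) M v i).symm

theorem hasEigenvector_endC {n : ℕ} {A : Matrix (Fin n) (Fin n) ℝ} {μ : ℂ} {z : Fin n → ℂ}
    (h : toC A *ᵥ z = μ • z) (hz : z ≠ 0) : (endC A).HasEigenvector μ z :=
  Module.End.hasEigenvector_iff.2 ⟨Module.End.mem_eigenspace_iff.2 h, hz⟩

theorem IsSymmetricFamily.transpose_mul_self {q n : ℕ} {m : Fin q → Fin q → ℕ}
    {C : ∀ i j : Fin q, Matrix (Fin (m i j)) (Fin n) ℝ} (hC : IsSymmetricFamily C) (i j : Fin q) :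
    (C i j)ᵀ * C i j = (C j i)ᵀ * C j i := by
  obtain ⟨h, hij⟩ := hC i j
  ext k l
  simp only [Matrix.mul_apply, Matrix.transpose_apply, hij]
  exact (finCongr h).sum_comp fun r => C j i r k * C j i r l

theorem eq_of_networkGraph_connected {q n : ℕ} {m : Fin q → Fin q → ℕ}
    {C : ∀ i j : Fin q, Matrix (Fin (m i j)) (Fin n) ℝ}
    (hconn : (networkGraph C).Connected) {β : Type*} (X : Fin q → β)
    (hX : ∀ i j, C i j ≠ 0 → X i = X j) (i j : Fin q) : X i = X j := by
  obtain ⟨p⟩ := hconn.preconnected i j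
  induction p with
  | nil => rfl
  | cons hadj _ ih =>
    refine Eq.trans ?_ ih
    obtain ⟨-, h | h⟩ := (SimpleGraph.fromRel_adj _ _ _).1 hadj
    · exact hX _ _ h
    · exact (hX _ _ h).symm

theorem IsBlockForm.isModalNetwork {q n n₁ n₂ : ℕ} {m : Fin q → Fin q → ℕ}
    {A : Matrix (Fin n) (Fin n) ℝ} {C : ∀ i j : Fin q, Matrix (Fin (m i j)) (Fin n) ℝ}
    (hC : IsSymmetricFamily C) (hconn : (networkGraph C).Connected)
    (hdet : ∀ i j : Fin q, C i j ≠ 0 → IsDetectable (C i j) A)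
    {U : Matrix (Fin n) (Fin n₁) ℝ} {W : Matrix (Fin n) (Fin n₂) ℝ}
    {S : Matrix (Fin n₁) (Fin n₁) ℝ} {F : Matrix (Fin n₂) (Fin n₂) ℝ} (h : IsBlockForm A U W S F) :
    ∃ (v₁ : Matrix (Fin n₁) (Fin n) ℂ) (v₂ : Matrix (Fin n₂) (Fin n) ℂ),
      IsModalNetwork (toC A) (toC U) (toC W) v₁ v₂ (toC S) (toC F) (fun i j => toC (C i j)) := by
  obtain ⟨⟨V, hVT, hTV, hblock⟩, hS, hF⟩ := h
  have hVA : V * A = Matrix.fromBlocks S 0 0 F * V := by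
    rw [← hblock, Matrix.mul_assoc, hTV, Matrix.mul_one]
  rw [← Matrix.fromRows_toRows V] at hVT hTV hVA
  generalize V.toRows₁ = V₁ at hVT hTV hVA
  generalize V.toRows₂ = V₂ at hVT hTV hVA
  rw [Matrix.fromRows_mul_fromCols, ← Matrix.fromBlocks_one, Matrix.fromBlocks_inj] at hVT
  rw [Matrix.fromCols_mul_fromRows] at hTV
  rw [Matrix.fromRows_mul, Matrix.fromBlocks_mul_fromRows, Matrix.fromRows_inj.eq_iff] at hVA
  refine ⟨toC V₁, toC V₂, ?_, ?_, ?_, ?_, ?_, ?_, fun μ z hz hμ => ?_, fun i j => ?_,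
    fun i j hij μ z hz hμ hcz => ?_, fun X hX => ?_⟩
  · rw [← toC_mul, ← toC_mul, hVA.1, Matrix.zero_mul, add_zero]
  · rw [← toC_mul, ← toC_mul, hVA.2, Matrix.zero_mul, zero_add]
  · rw [← toC_mul, hVT.1, toC_one]
  · rw [← toC_mul, hVT.2.2.1, toC_zero]
  · rw [← toC_mul, ← toC_mul, ← toC_add, hTV, toC_one]
  · rw [conjTranspose_toC, hS, toC_neg]
  · by_contra hz0
    exact absurd (hF μ (Module.End.hasEigenvalue_of_hasEigenvector (hasEigenvector_endC hz hz0)))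
      hμ.not_gt
  · rw [conjTranspose_toC, conjTranspose_toC, ← toC_mul, ← toC_mul, hC.transpose_mul_self]
  · by_contra hz0
    exact hdet i j (fun h0 => hij (by rw [h0, toC_zero])) μ z (hasEigenvector_endC hz hz0) hμ hcz
  · refine eq_of_networkGraph_connected hconn X fun i j hij => hX i j fun h0 => hij ?_
    ext k l
    simpa [toC] using congrFun (congrFun h0 k) l

theorem isStable_of_numImagEigenvalues_eq_zero {n : ℕ} {A : Matrix (Fin n) (Fin n) ℝ}
    (hA : IsNeutrallyStable A) (h0 : numImagEigenvalues A = 0) : IsStable A := by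
  intro μ hμ
  refine lt_of_le_of_ne (not_lt.1 (hA.1 μ hμ)) fun hre => ?_
  rw [numImagEigenvalues, Multiset.card_eq_zero, Multiset.filter_eq_nil] at h0
  refine h0 μ ((Polynomial.mem_roots (Matrix.charpoly_monic _).ne_zero).2 ?_) hre
  rwa [Module.End.hasEigenvalue_iff_isRoot_charpoly, endC, Matrix.charpoly_toLin'] at hμ

/-- Lets the case of no imaginary eigenvalues run through the general argument: with zero columns in
`U`, the gain `U Uᵀ Cᵀ` is zero. -/
theorem isBlockForm_of_isStable {n : ℕ} {A : Matrix (Fin n) (Fin n) ℝ} (hA : IsStable A) :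
    IsBlockForm A (0 : Matrix (Fin n) (Fin 0) ℝ) 1 0 A := by
  refine ⟨⟨Matrix.fromRows 0 1, ?_, ?_, ?_⟩, Subsingleton.elim _ _, hA⟩
  · rw [Matrix.fromRows_mul_fromCols, ← Matrix.fromBlocks_one]
    congr 1
    · exact Subsingleton.elim _ _
    all_goals simp
  · simp [Matrix.fromCols_mul_fromRows]
  · rw [Matrix.fromRows_mul, Matrix.fromRows_mul_fromCols]
    simp

/-- Whatever the splitting of `A` into a skew-symmetric and a stable block, the gains `U Uᵀ Cᵀ`
synchronize the network and keep it bounded. -/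
theorem IsBlockForm.synchronize {q n n₁ n₂ : ℕ} {m : Fin q → Fin q → ℕ}
    {A : Matrix (Fin n) (Fin n) ℝ} {C : ∀ i j : Fin q, Matrix (Fin (m i j)) (Fin n) ℝ}
    {G : ∀ i j : Fin q, Matrix (Fin n) (Fin (m i j)) ℝ}
    (hC : IsSymmetricFamily C) (hconn : (networkGraph C).Connected)
    (hdet : ∀ i j : Fin q, C i j ≠ 0 → IsDetectable (C i j) A)
    {U : Matrix (Fin n) (Fin n₁) ℝ} {W : Matrix (Fin n) (Fin n₂) ℝ}
    {S : Matrix (Fin n₁) (Fin n₁) ℝ} {F : Matrix (Fin n₂) (Fin n₂) ℝ} (h : IsBlockForm A U W S F)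
    (hG : ∀ i j, G i j = U * Uᵀ * (C i j)ᵀ) : Synchronize A C G ∧ SolutionsBounded A C G := by
  obtain ⟨v₁, v₂, hnet⟩ := h.isModalNetwork hC hconn hdet
  have main : ∀ x : Fin q → ℝ → Fin n → ℝ, IsSolution A C G x → ∀ i j : Fin q,
      (∃ B : ℝ, ∀ t : ℝ, 0 ≤ t → ‖fun i k => (x i t k : ℂ)‖ ≤ B) ∧
      Filter.Tendsto (fun t k => (x i t k : ℂ) - (x j t k : ℂ)) Filter.atTop
        (𝓝 (0 : Fin n → ℂ)) := by
    intro x hx i j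
    refine bounded_and_tendsto_of_solution (coupled (toC A) (toC U) fun i j => toC (C i j))
      (LinearMap.proj (φ := fun _ : Fin q => Fin n → ℂ) i -
        LinearMap.proj (R := ℂ) (φ := fun _ : Fin q => Fin n → ℂ) j)
      (fun μ X hX hμ => hnet.eq_zero_of_re_pos μ X hX hμ)
      (fun μ X hμ hX => hnet.semisimple_of_re_eq_zero μ X hμ hX)
      (fun μ X hX hμ => by
        rw [LinearMap.sub_apply, LinearMap.proj_apply, LinearMap.proj_apply]
        exact sub_eq_zero.2 (hnet.synchronous_of_re_eq_zero μ X hX hμ i j))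
      (fun t i k => (x i t k : ℂ)) fun t ht => ?_
    refine hasDerivWithinAt_pi.2 fun i => hasDerivWithinAt_pi.2 fun k => ?_
    refine ((hasDerivWithinAt_pi.1 (hx i t ht) k).ofReal_comp).congr_deriv ?_
    rw [coupled_apply, control, Pi.add_apply, Pi.add_apply, Complex.ofReal_add, toC_mulVec,
      Finset.sum_apply, Finset.sum_apply, Complex.ofReal_sum]
    refine congrArg _ (Finset.sum_congr rfl fun j _ => ?_)
    rw [hG, Matrix.mulVec_mulVec, ← toC_mulVec]
    simp only [conjTranspose_toC, ← toC_mul, Matrix.mul_assoc]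
    refine congrFun (congrArg _ (funext fun l => ?_)) k
    simp
  constructor
  · intro x hx i j
    have hlim : Filter.Tendsto (fun t => x i t - x j t) Filter.atTop (𝓝 0) := by
      refine tendsto_pi_nhds.2 fun k => ?_
      have h1 := (Complex.continuous_re.tendsto 0).comp (tendsto_pi_nhds.1 (main x hx i j).2 k)
      simpa [Function.comp_def] using h1
    have h2 := ((PiLp.continuousLinearEquiv 2 ℝ fun _ : Fin n => ℝ).symm.continuous.norm.tendsto
      0).comp hlim
    simpa [Function.comp_def] using h2
  · intro x hx i
    obtain ⟨B, hB⟩ := (main x hx i i).1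
    -- The complex bound is in the sup norm; the operator norm of the identification with Euclidean
    -- space converts it.
    refine ⟨‖((PiLp.continuousLinearEquiv 2 ℝ fun _ : Fin n => ℝ).symm :
      (Fin n → ℝ) →L[ℝ] EuclideanSpace ℝ (Fin n))‖ * B, fun t ht => ?_⟩
    refine (ContinuousLinearMap.le_opNorm ((PiLp.continuousLinearEquiv 2 ℝ
      fun _ : Fin n => ℝ).symm : (Fin n → ℝ) →L[ℝ] EuclideanSpace ℝ (Fin n)) (x i t)).trans
      (mul_le_mul_of_nonneg_left ?_ (norm_nonneg _))
    refine (pi_norm_le_iff_of_nonneg ((norm_nonneg _).trans (hB t ht))).2 fun k => ?_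
    rw [← Complex.norm_real]
    exact ((norm_le_pi_norm (fun k => (x i t k : ℂ)) k).trans
      (norm_le_pi_norm (fun i k => (x i t k : ℂ)) i)).trans (hB t ht)

end MatrixSync

theorem mainTheorem1 {q n : ℕ} {m : Fin q → Fin q → ℕ}
    (A : Matrix (Fin n) (Fin n) ℝ)
    (C : ∀ i j : Fin q, Matrix (Fin (m i j)) (Fin n) ℝ)
    (G : ∀ i j : Fin q, Matrix (Fin n) (Fin (m i j)) ℝ)
    (hC_diag : ∀ i : Fin q, C i i = 0)
    (hC_symm : MatrixSync.IsSymmetricFamily C)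
    (hconn : (MatrixSync.networkGraph C).Connected)
    (hA : MatrixSync.IsNeutrallyStable A)
    (hdet : ∀ i j : Fin q, C i j ≠ 0 → MatrixSync.IsDetectable (C i j) A)
    (hG : MatrixSync.IsConstructedGain A C G) :
    MatrixSync.Synchronize A C G ∧ MatrixSync.SolutionsBounded A C G := by
  by_cases h0 : MatrixSync.numImagEigenvalues A = 0
  · refine (MatrixSync.isBlockForm_of_isStable
      (MatrixSync.isStable_of_numImagEigenvalues_eq_zero hA h0)).synchronize hC_symm hconn hdet
      fun i j => ?_
    rw [hG.1 h0, Matrix.zero_mul, Matrix.zero_mul]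
  · obtain ⟨U, W, S, F, hblock, hGU⟩ := hG.2 h0
    exact hblock.synchronize hC_symm hconn hdet hGU
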